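/- For real $x,y$ and $p,q\ge 0$ put $$\mathrm B(x,y;p,q)=\int_0^1 t^{x-1}(1-t)^{y-1}e^{-\frac pt-\frac q{1-t}}\,dt,\qquad \mathrm B(x,y)=\mathrm B(x,y;0,0),$$ and for $c>b>0$, $|z|<1$ let $$F_{p,q}(\alpha,b;c;z)=\sum_{n\ge 0}(\alpha)_n\,\frac{\mathrm B(b+n,c-b;p,q)}{\mathrm B(b,c-b)}\,\frac{z^n}{n!}$$ be the $(p,q)$-extended Gauss hypergeometric function. Let $a:\mathbb R^+\to\mathbb R^+$ be a strictly increasing function whose range contains $[a(1),\infty)$, put $a_n=a(n)$ for integers $n\ge 1$ (so that $a_n\to\infty$), let $[a^{-1}(x)]$ be the integer part of $a^{-1}(x)$, and write $$\mathscr U_a(s,t)=\int_{a_1}^\infty\frac{[a^{-1}(x)]}{x^s(x+r^2)^t}\,dx,\qquad \mathfrak E_{p,q}=e^{-(\sqrt p+\sqrt q)^2}.$$ Let $\lambda\in(0,1]$, $\eta>0$, $r\in(0,\sqrt{a_1})$, $p,q\ge 0$ and $c>b>0$. **(i)** If $\mathscr U_a(\lambda,\eta)$ converges, then so do $\mathscr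 U_a(\lambda+1,\eta)$, $\mathscr U_a(\lambda,\eta+1)$, $\mathscr U_a(\lambda-1,\eta+1)$ and the series $$\mathfrak F_{\lambda,\eta}(F_{p,q};\boldsymbol a;r)=\sum_{n\ge 1}\frac{F_{p,q}\left(\lambda,b;c;-\frac{r^2}{a_n}\right)}{a_n^{\lambda}(a_n+r^2)^{\eta}},$$ and $$\begin{aligned}\mathfrak F_{\lambda,\eta}(F_{p,q};\boldsymbol a;r)\le{}&\lambda\,\mathfrak E_{p,q}\Bigg\{\left(1-\frac{2(\lambda+1)b(c+1)}{c(\lambda+2)(b+1)}\right)\mathscr U_a(\lambda+1,\eta)+\frac{4(\lambda+1)b(c+1)^2\,\mathscr U_a(\lambda,\eta)}{c(\lambda+2)(b+1)\,[(\lambda+2)(b+1)r^2+2(c+1)a_1]}\Bigg\}\\&+\eta\,\mathfrak E_{p,q}\Bigg\{\left(1-\frac{2\lambda b(c+1)}{c(\lambda+1)(b+1)}\right)\mathscr U_a(\lambda,\eta+1)+\frac{4\lambda b(c+1)^2\,\mathscr U_a(\lambda-1,\eta+1)}{c(\lambda+1)(b+1)\,[(\lambda+1)(b+1)r^2+2(c+1)a_1]}\Bigg\}.\end{aligned}$$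 **(ii)** If $\lambda+\eta>1$, then the alternating series $$\widetilde{\mathfrak F}_{\lambda,\eta}(F_{p,q};\boldsymbol a;r)=\sum_{n\ge 1}\frac{(-1)^{n-1}F_{p,q}\left(\lambda,b;c;-\frac{r^2}{a_n}\right)}{a_n^{\lambda}(a_n+r^2)^{\eta}}$$ converges (as the limit of its partial sums), and $$\begin{aligned}\widetilde{\mathfrak F}_{\lambda,\eta}(F_{p,q};\boldsymbol a;r)\le{}&\lambda\,\mathfrak E_{p,q}\Bigg\{\left(1-\frac{2(\lambda+1)b(c+1)}{c(\lambda+2)(b+1)}\right)\frac{{}_2F_1\left(\eta,\lambda+\eta;\lambda+\eta+1;-\frac{r^2}{a_1}\right)}{(\lambda+\eta)\,a_1^{\lambda+\eta}}\\&\quad+\frac{4(\lambda+1)b(c+1)^2}{c(\lambda+2)(b+1)}\,\frac{a_1^{1-\lambda-\eta}\,{}_2F_1\left(\eta,\lambda+\eta-1;\lambda+\eta;-\frac{r^2}{a_1}\right)}{(\lambda+\eta-1)[(\lambda+2)(b+1)r^2+2(c+1)a_1]}\Bigg\}\\&+\eta\,\mathfrak E_{p,q}\Bigg\{\left(1-\frac{2\lambda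 b(c+1)}{c(\lambda+1)(b+1)}\right)\frac{{}_2F_1\left(\eta+1,\lambda+\eta;\lambda+\eta+1;-\frac{r^2}{a_1}\right)}{(\lambda+\eta)\,a_1^{\lambda+\eta}}\\&\quad+\frac{4\lambda b(c+1)^2}{c(\lambda+1)(b+1)}\,\frac{a_1^{1-\lambda-\eta}\,{}_2F_1\left(\eta+1,\lambda+\eta-1;\lambda+\eta;-\frac{r^2}{a_1}\right)}{(\lambda+\eta-1)[(\lambda+1)(b+1)r^2+2(c+1)a_1]}\Bigg\}.\end{aligned}$$ -/

import Mathlib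

open Filter Topology Set

noncomputable section

/-- The `(p, q)`-extended Beta function
`B(x, y; p, q) = ∫₀¹ t^(x-1) (1-t)^(y-1) exp(-p/t - q/(1-t)) dt`, for real arguments.
At `p = q = 0` it is the Eulerian Beta function `B(x, y)`. -/
def extBeta (x y p q : ℝ) : ℝ :=
  ∫ t in (0 : ℝ)..1, t ^ (x - 1) * (1 - t) ^ (y - 1) * Real.exp (-p / t - q / (1 - t))

/-- The `(p, q)`-extended Gauss hypergeometric function
`F_{p,q}(α, b; c; z) = ∑_{n ≥ 0} (α)_n B(b + n, c - b; p, q) / B(b, c - b) * z^n / n!`,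
used for `c > b > 0` and `|z| < 1`, where the series converges absolutely. -/
def extGauss (p q α b c z : ℝ) : ℝ :=
  ∑' n : ℕ, (ascPochhammer ℝ n).eval α *
    (extBeta (b + n) (c - b) p q / extBeta b (c - b) 0 0) * (z ^ n / (n.factorial : ℝ))

/-- The `n`-th term (`n ≥ 1`) of the Mathieu-type series:
`F_{p,q}(lam, b; c; -r²/a_n) / (a_n^lam (a_n + r²)^eta)`, where `a_n = a(n)`. -/
def mathieuTerm (lam eta p q b c : ℝ) (a : ℝ → ℝ) (r : ℝ) (n : ℕ) : ℝ :=
  extGauss p q lam b c (-r ^ 2 / a n) / (a n ^ lam * (a n + r ^ 2) ^ eta)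

/-- The Mathieu-type series, summed over the indices `n ≥ 1`. -/
def mathieuSeries (lam eta p q b c : ℝ) (a : ℝ → ℝ) (r : ℝ) : ℝ :=
  ∑' n : ℕ, mathieuTerm lam eta p q b c a r (n + 1)

/-- The partial sum over `1 ≤ n ≤ N` of the alternating Mathieu-type series
(the sign of the `n`-th term is `(-1)^(n-1)`). -/
def altMathieuPartialSum (lam eta p q b c : ℝ) (a : ℝ → ℝ) (r : ℝ) (N : ℕ) : ℝ :=
  ∑ n ∈ Finset.Icc 1 N, (-1 : ℝ) ^ (n - 1) * mathieuTerm lam eta p q b c a r n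

/-- The inverse of `a` as a function on the positive reals. -/
def invPos (a : ℝ → ℝ) : ℝ → ℝ := Function.invFunOn a (Ioi 0)

/-- The integrand `[a⁻¹(x)] / (x^s (x + r²)^t)` of the integral `𝒰_a(s, t)`;
`[·]` is the integer part. -/
def uIntegrand (a : ℝ → ℝ) (r s t x : ℝ) : ℝ :=
  (⌊invPos a x⌋ : ℝ) / (x ^ s * (x + r ^ 2) ^ t)

/-- `𝒰_a(s, t)` converges. -/
def UConverges (a : ℝ → ℝ) (r s t : ℝ) : Prop :=
  MeasureTheory.IntegrableOn (uIntegrand a r s t) (Ioi (a 1))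

/-- `𝒰_a(s, t) = ∫_{a₁}^∞ [a⁻¹(x)] / (x^s (x + r²)^t) dx`. -/
def uInt (a : ℝ → ℝ) (r s t : ℝ) : ℝ :=
  ∫ x in Ioi (a 1), uIntegrand a r s t x

/-- `𝔈_{p,q} = exp(-(√p + √q)²)`. -/
def frakE (p q : ℝ) : ℝ := Real.exp (-(√p + √q) ^ 2)

end

/-!
Write `g y = F_{p,q}(l, b; c; -r ^ 2 / y) / (y ^ l * (y + r ^ 2) ^ eta)` for the Mathieu term at
`a n = y`. By Euler's integral (`extGauss_eq_integral`), `g` is nonnegative, decreasing and tends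
to `0`, and the factor `exp (-p / t - q / (1 - t))` can be replaced by its upper bound `frakE p q`.

Both parts of the theorem follow from one estimate, `extGauss_div_le_integral`: for `z ≥ a 1`,
`g z ≤ frakE p q * ∫ x in Ioi z, D x`, where `D = mathieuMajorant` is built from affine majorants
`A₁ + K₁ x` and `A₂ + K₂ x` of Luke's rational bounds for the parameters `l + 1` and `l`. In the
first part these tails are summed over `z = a n`: the sum of their indicators at `x` is at most the
integer part of `a⁻¹ x` (`sum_integral_Ioi_le`). In the second part the sum of the alternating
series is at most `g (a 1)`, and the integral of `D` is a combination of Gauss functions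
(`integral_mathieuMajorant`).

One might expect the estimate to come from the pointwise inequality `-g' ≤ frakE p q * D`.
Replacing the hypergeometric functions in `-g'` by their majorants would need Luke's bound at the
parameter `l + 1`, but it holds for parameters in `(0, 1]` and can fail beyond `1`. The proof here
applies Luke's bound at `l` only (`extGauss_neg_le`), which gives `g z ≤ frakE p q * H z` with
`H x = (A₂ + K₂ x) / (x ^ l * (x + r ^ 2) ^ eta)`, and then compares `D` with `-H'`. The difference
`D + H'` is a positive multiple of `l * ((A₁ + K₁ x) - (A₂ + K₂ x)) + K₂ x`, which is nonnegative
for `x ≥ a 1 > r ^ 2` (`luke_comparison`). As `H` vanishes at infinity when `1 < l + eta`,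
integration yields `H z ≤ ∫ x in Ioi z, D x` (`mathieuKernel_mul_le_integral`).
-/

open MeasureTheory

/-! ### The binomial series -/

/-- The binomial series, with coefficients written as Pochhammer symbols. -/
theorem hasSum_ascPochhammer_pow (α : ℝ) {x : ℝ} (hx : |x| < 1) :
    HasSum (fun n : ℕ => (ascPochhammer ℝ n).eval α * (x ^ n / (n.factorial : ℝ)))
      ((1 - x) ^ (-α)) := by
  have h := (Real.one_div_one_sub_rpow_hasFPowerSeriesOnBall_zero α).hasSum (y := x)
    (by simpa [enorm_eq_nnnorm, ← NNReal.coe_lt_coe] using hx)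
  have h1 : 0 < 1 - x := by linarith [(abs_lt.mp hx).2]
  simp only [zero_add, FormalMultilinearSeries.ofScalars_apply_eq, smul_eq_mul] at h
  rw [Real.rpow_neg h1.le, ← one_div]
  refine (congrArg (HasSum · _) (funext fun n => ?_)).mpr h
  have h2 := Ring.factorial_nsmul_multichoose_eq_ascPochhammer α n
  rw [Polynomial.ascPochhammer_smeval_eq_eval, nsmul_eq_mul] at h2
  have h3 : Ring.choose (α + n - 1) n = Ring.multichoose α n := by
    rw [Ring.choose]; congr 1; ring
  rw [h3, ← h2]
  have : (n.factorial : ℝ) ≠ 0 := by positivity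
  field_simp

/-! ### The extended Beta integral -/

/-- The integrand of the `(p, q)`-extended Beta function. -/
noncomputable def betaWeight (x y p q t : ℝ) : ℝ :=
  t ^ (x - 1) * (1 - t) ^ (y - 1) * Real.exp (-p / t - q / (1 - t))

theorem extBeta_eq_setIntegral (x y p q : ℝ) :
    extBeta x y p q = ∫ t in Ioo (0 : ℝ) 1, betaWeight x y p q t := by
  rw [extBeta, intervalIntegral.integral_of_le zero_le_one, integral_Ioc_eq_integral_Ioo]
  rfl

theorem betaWeight_pos {x y p q t : ℝ} (ht : t ∈ Ioo (0 : ℝ) 1) : 0 < betaWeight x y p q t := by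
  have h0 := ht.1
  have h1 : 0 < 1 - t := by linarith [ht.2]
  unfold betaWeight; positivity

theorem continuousOn_betaWeight (x y p q : ℝ) :
    ContinuousOn (betaWeight x y p q) (Ioo (0 : ℝ) 1) := by
  intro t ht
  have h0 := ht.1.ne'
  have h1 : 1 - t ≠ 0 := by linarith [ht.2]
  unfold betaWeight
  apply ContinuousAt.continuousWithinAt
  fun_prop (disch := first | assumption | exact Or.inl ‹_›)

theorem betaWeight_add_natCast {x y p q t : ℝ} (ht : t ∈ Ioo (0 : ℝ) 1) (n : ℕ) :
    betaWeight (x + n) y p q t = betaWeight x y p q t * t ^ n := by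
  unfold betaWeight
  rw [show x + n - 1 = (x - 1) + n by ring, Real.rpow_add_natCast ht.1.ne']
  ring

theorem ofReal_betaWeight_zero {x y t : ℝ} (ht : t ∈ Ioo (0 : ℝ) 1) :
    ((betaWeight x y 0 0 t : ℝ) : ℂ) = (t : ℂ) ^ ((x : ℂ) - 1) * (1 - (t : ℂ)) ^ ((y : ℂ) - 1) := by
  have h1 : 0 ≤ 1 - t := by linarith [ht.2]
  simp only [betaWeight, neg_zero, zero_div, sub_zero, Real.exp_zero, mul_one]
  push_cast [Complex.ofReal_cpow ht.1.le, Complex.ofReal_cpow h1]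
  rfl

theorem integrableOn_betaWeight_zero {x y : ℝ} (hx : 0 < x) (hy : 0 < y) :
    IntegrableOn (betaWeight x y 0 0) (Ioo (0 : ℝ) 1) := by
  have h := Complex.betaIntegral_convergent (u := x) (v := y) (by simpa) (by simpa)
  rw [intervalIntegrable_iff_integrableOn_Ioo_of_le zero_le_one] at h
  refine Integrable.congr h.re ?_
  filter_upwards [ae_restrict_mem measurableSet_Ioo] with t ht
  rw [← ofReal_betaWeight_zero ht]
  simp

theorem extBeta_zero_eq_beta {x y : ℝ} (hx : 0 < x) (hy : 0 < y) :
    extBeta x y 0 0 = ProbabilityTheory.beta x y := by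
  rw [ProbabilityTheory.beta_eq_betaIntegralReal x y hx hy, Complex.betaIntegral,
    intervalIntegral.integral_of_le zero_le_one, integral_Ioc_eq_integral_Ioo,
    extBeta_eq_setIntegral]
  rw [← setIntegral_congr_fun measurableSet_Ioo fun t ht => ofReal_betaWeight_zero ht,
    integral_complex_ofReal, Complex.ofReal_re]

theorem extBeta_zero_pos {x y : ℝ} (hx : 0 < x) (hy : 0 < y) : 0 < extBeta x y 0 0 := by
  rw [extBeta_zero_eq_beta hx hy]; exact ProbabilityTheory.beta_pos hx hy

theorem extBeta_zero_add_one {x y : ℝ} (hx : 0 < x) (hy : 0 < y) :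
    extBeta (x + 1) y 0 0 = x / (x + y) * extBeta x y 0 0 := by
  rw [extBeta_zero_eq_beta hx hy, extBeta_zero_eq_beta (by linarith) hy]
  have h : 0 < x + y := by linarith
  have := Real.Gamma_pos_of_pos h
  rw [ProbabilityTheory.beta, ProbabilityTheory.beta, show x + 1 + y = x + y + 1 by ring,
    Real.Gamma_add_one hx.ne', Real.Gamma_add_one h.ne']
  field_simp

/-- The exponential factor is at most `frakE p q`, since
`p / t + q / (1 - t) ≥ (√p + √q) ^ 2` by the Cauchy-Schwarz inequality. -/
theorem betaWeight_le {x y p q t : ℝ} (hp : 0 ≤ p) (hq : 0 ≤ q) (ht : t ∈ Ioo (0 : ℝ) 1) :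
    betaWeight x y p q t ≤ frakE p q * betaWeight x y 0 0 t := by
  have h0 := ht.1
  have h1 : 0 < 1 - t := by linarith [ht.2]
  have key : (√p + √q) ^ 2 ≤ p / t + q / (1 - t) := by
    rw [div_add_div _ _ h0.ne' h1.ne', le_div_iff₀ (by positivity)]
    nlinarith [sq_nonneg (√p * (1 - t) - √q * t), Real.sq_sqrt hp, Real.sq_sqrt hq]
  have h2 : Real.exp (-p / t - q / (1 - t)) ≤ frakE p q := by
    rw [frakE]; apply Real.exp_le_exp.mpr; rw [neg_div]; linarith
  have h3 : 0 ≤ t ^ (x - 1) * (1 - t) ^ (y - 1) := by positivity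
  simp only [betaWeight, neg_zero, zero_div, sub_zero, Real.exp_zero, mul_one]
  rw [mul_comm (frakE p q)]
  exact mul_le_mul_of_nonneg_left h2 h3

theorem integrableOn_betaWeight {x y p q : ℝ} (hx : 0 < x) (hy : 0 < y) (hp : 0 ≤ p)
    (hq : 0 ≤ q) : IntegrableOn (betaWeight x y p q) (Ioo (0 : ℝ) 1) := by
  refine ((integrableOn_betaWeight_zero hx hy).const_mul (frakE p q)).mono'
    ((continuousOn_betaWeight x y p q).aestronglyMeasurable measurableSet_Ioo) ?_
  filter_upwards [ae_restrict_mem measurableSet_Ioo] with t ht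
  rw [Real.norm_of_nonneg (betaWeight_pos ht).le]
  exact betaWeight_le hp hq ht

theorem integrableOn_betaWeight_mul {x y p q M : ℝ} {f : ℝ → ℝ} (hx : 0 < x) (hy : 0 < y)
    (hp : 0 ≤ p) (hq : 0 ≤ q) (hf : ContinuousOn f (Ioo 0 1))
    (hM : ∀ t ∈ Ioo (0 : ℝ) 1, |f t| ≤ M) :
    IntegrableOn (fun t => betaWeight x y p q t * f t) (Ioo (0 : ℝ) 1) := by
  refine (integrableOn_betaWeight hx hy hp hq).mul_bdd (c := M)
    (hf.aestronglyMeasurable measurableSet_Ioo) ?_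
  filter_upwards [ae_restrict_mem measurableSet_Ioo] with t ht
  exact hM t ht

/-! ### Euler's integral for the extended hypergeometric function -/

/-- Euler's integral for the extended hypergeometric function: the binomial series of
`(1 - z t) ^ (-α)` is integrated term by term against the Beta integrand. -/
theorem extGauss_eq_integral {p q α b c z : ℝ} (hp : 0 ≤ p) (hq : 0 ≤ q) (hα : 0 < α) (hb : 0 < b)
    (hbc : b < c) (hz : |z| < 1) :
    extGauss p q α b c z =
      (∫ t in Ioo (0 : ℝ) 1, betaWeight b (c - b) p q t * (1 - z * t) ^ (-α))
        / extBeta b (c - b) 0 0 := by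
  have hd : 0 < c - b := by linarith
  set k : ℕ → ℝ := fun n => (ascPochhammer ℝ n).eval α / (n.factorial : ℝ) with hk
  have hk0 : ∀ n, 0 ≤ k n := fun n => by
    have := ascPochhammer_pos n α hα
    positivity
  set F : ℕ → ℝ → ℝ := fun n t => betaWeight b (c - b) p q t * (k n * (z * t) ^ n) with hF
  have hI : ∀ n, Integrable (F n) (volume.restrict (Ioo (0 : ℝ) 1)) := fun n => by
    refine integrableOn_betaWeight_mul hb hd hp hq (M := k n) (by fun_prop) fun t ht => ?_
    rw [abs_mul, abs_of_nonneg (hk0 n), abs_pow, abs_mul, abs_of_pos ht.1]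
    refine mul_le_of_le_one_right (hk0 n) (pow_le_one₀ (by have := ht.1; positivity) ?_)
    nlinarith [ht.1, ht.2, abs_nonneg z]
  have hS : Summable fun n => ∫ t in Ioo (0 : ℝ) 1, ‖F n t‖ := by
    have h1 : Summable fun n => k n * |z| ^ n * extBeta b (c - b) p q := by
      apply Summable.mul_right
      refine (hasSum_ascPochhammer_pow α (x := |z|) (by simpa)).summable.congr fun n => ?_
      simp only [hk]; ring
    refine h1.of_nonneg_of_le (fun n => by positivity) fun n => ?_
    rw [extBeta_eq_setIntegral, ← integral_const_mul]
    refine setIntegral_mono_on (hI n).norm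
      ((integrableOn_betaWeight hb hd hp hq).const_mul _) measurableSet_Ioo fun t ht => ?_
    have hw := (betaWeight_pos (x := b) (y := c - b) (p := p) (q := q) ht).le
    rw [Real.norm_eq_abs, hF]
    simp only
    rw [abs_mul, abs_mul, abs_of_nonneg hw, abs_of_nonneg (hk0 n), abs_pow, abs_mul,
      abs_of_pos ht.1, mul_comm]
    have := hk0 n
    have := ht.1.le
    have := ht.2.le
    gcongr
    exact mul_le_of_le_one_right (abs_nonneg z) ht.2.le
  have hsum := hasSum_integral_of_summable_integral_norm hI hS
  have e1 : ∀ n, ∫ t in Ioo (0 : ℝ) 1, F n t = k n * z ^ n * extBeta (b + n) (c - b) p q := by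
    intro n
    rw [extBeta_eq_setIntegral, ← integral_const_mul]
    refine setIntegral_congr_fun measurableSet_Ioo fun t ht => ?_
    simp only [hF, betaWeight_add_natCast ht n]
    ring
  have e2 : ∫ t in Ioo (0 : ℝ) 1, ∑' n, F n t =
      ∫ t in Ioo (0 : ℝ) 1, betaWeight b (c - b) p q t * (1 - z * t) ^ (-α) := by
    refine setIntegral_congr_fun measurableSet_Ioo fun t ht => ?_
    have hzt : |z * t| < 1 := by
      rw [abs_mul, abs_of_pos ht.1]; nlinarith [ht.1, ht.2, abs_nonneg z]
    have := (hasSum_ascPochhammer_pow α hzt).mul_left (betaWeight b (c - b) p q t)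
    rw [← this.tsum_eq]
    refine tsum_congr fun n => ?_
    simp only [hF, hk]; ring
  rw [e2] at hsum
  rw [extGauss, ← hsum.tsum_eq, ← tsum_div_const]
  refine tsum_congr fun n => ?_
  rw [e1]
  simp only [hk]
  ring

/-! ### Luke's rational bound -/

/-- The `[1/1]` Padé approximant of `(1 + v) ^ (-l)` bounds it from above for `0 < l ≤ 1`. -/
theorem one_add_rpow_neg_le {l v : ℝ} (hl0 : 0 < l) (hl1 : l ≤ 1) (hv : 0 ≤ v) :
    (1 + v) ^ (-l) ≤ 1 - 2 * l * v / ((l + 1) * v + 2) := by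
  -- The logarithm of the quotient of the two sides vanishes at `0` and increases on `[0, ∞)`.
  set h : ℝ → ℝ := fun v => l * Real.log (1 + v) + Real.log (2 + (1 - l) * v)
    - Real.log (2 + (1 + l) * v) with hh
  have h1l : 0 ≤ 1 - l := by linarith
  have hd : ∀ x : ℝ, 0 ≤ x → HasDerivAt h
      (l * (1 / (1 + x)) + (1 - l) / (2 + (1 - l) * x) - (1 + l) / (2 + (1 + l) * x)) x := by
    intro x hx
    have p1 : 1 + x ≠ 0 := by positivity
    have p2 : 2 + (1 - l) * x ≠ 0 := by positivity
    have p3 : 2 + (1 + l) * x ≠ 0 := by positivity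
    have d1 := (((hasDerivAt_id x).const_add 1).log p1).const_mul l
    have d2 := (((hasDerivAt_id x).const_mul (1 - l)).const_add 2).log p2
    have d3 := (((hasDerivAt_id x).const_mul (1 + l)).const_add 2).log p3
    exact ((d1.add d2).sub d3).congr_deriv (by simp)
  have hmono : MonotoneOn h (Ici 0) := by
    apply monotoneOn_of_deriv_nonneg (convex_Ici 0)
    · exact fun x hx => (hd x hx).continuousAt.continuousWithinAt
    · intro x hx
      rw [interior_Ici] at hx
      exact (hd x (le_of_lt hx)).differentiableAt.differentiableWithinAt
    · intro x hx
      rw [interior_Ici] at hx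
      have hx : 0 < x := hx
      rw [(hd x hx.le).deriv]
      have p1 : 0 < 1 + x := by positivity
      have p2 : 0 < 2 + (1 - l) * x := by positivity
      have p3 : 0 < 2 + (1 + l) * x := by positivity
      have : l * (1 / (1 + x)) + (1 - l) / (2 + (1 - l) * x) - (1 + l) / (2 + (1 + l) * x)
          = l * (1 - l) * (1 + l) * x ^ 2 /
            ((1 + x) * (2 + (1 - l) * x) * (2 + (1 + l) * x)) := by
        field_simp; ring
      rw [this]; positivity
  have h0 : 0 ≤ h v := by
    have := hmono (mem_Ici.mpr le_rfl) (mem_Ici.mpr hv) hv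
    simpa [hh] using this
  have p1 : 0 < 1 + v := by positivity
  have p2 : 0 < 2 + (1 - l) * v := by positivity
  have p3 : 0 < 2 + (1 + l) * v := by positivity
  have e : 1 - 2 * l * v / ((l + 1) * v + 2) = (2 + (1 - l) * v) / (2 + (1 + l) * v) := by
    have : (l + 1) * v + 2 ≠ 0 := by positivity
    field_simp; ring
  rw [e, ← Real.log_le_log_iff (by positivity) (by positivity), Real.log_rpow p1,
    Real.log_div p2.ne' p3.ne']
  simp only [hh] at h0
  linarith

/-- The convex function `t ↦ 1 / (k t + 2)` lies above its tangent at `m`. -/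
theorem one_div_ge_tangent {k m t : ℝ} (hk : 0 ≤ k) (hm : 0 ≤ m) (ht : 0 ≤ t) :
    1 / (k * m + 2) - k * (t - m) / (k * m + 2) ^ 2 ≤ 1 / (k * t + 2) := by
  have h1 : 0 < k * m + 2 := by positivity
  have h2 : 0 < k * t + 2 := by positivity
  have : 1 / (k * t + 2) - (1 / (k * m + 2) - k * (t - m) / (k * m + 2) ^ 2)
      = k ^ 2 * (t - m) ^ 2 / ((k * t + 2) * (k * m + 2) ^ 2) := by
    field_simp; ring
  have : 0 ≤ 1 / (k * t + 2) - (1 / (k * m + 2) - k * (t - m) / (k * m + 2) ^ 2) := by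
    rw [this]; positivity
  linarith

theorem setIntegral_betaWeight_zero_mul_pow {x y : ℝ} (n : ℕ) :
    ∫ t in Ioo (0 : ℝ) 1, betaWeight x y 0 0 t * t ^ n = extBeta (x + n) y 0 0 := by
  rw [extBeta_eq_setIntegral]
  exact setIntegral_congr_fun measurableSet_Ioo fun t ht => (betaWeight_add_natCast ht n).symm

theorem abs_one_sub_mul_rpow_neg_le {l u t : ℝ} (hl : 0 ≤ l) (hu : 0 ≤ u)
    (ht : t ∈ Ioo (0 : ℝ) 1) : |(1 - -u * t) ^ (-l)| ≤ 1 := by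
  have : 0 ≤ u * t := mul_nonneg hu ht.1.le
  rw [abs_of_nonneg (by apply Real.rpow_nonneg; linarith)]
  exact Real.rpow_le_one_of_one_le_of_nonpos (by linarith) (by linarith)

theorem continuousOn_one_sub_mul_rpow {l u : ℝ} (hu : 0 ≤ u) :
    ContinuousOn (fun t : ℝ => (1 - -u * t) ^ (-l)) (Ioo 0 1) := by
  intro t ht
  have : 1 - -u * t ≠ 0 := by nlinarith [ht.1]
  apply ContinuousAt.continuousWithinAt
  fun_prop (disch := exact Or.inl this)

/-- Luke's rational upper bound for `₂F₁(l, b; c; -u)`, multiplied by `frakE p q`. It is the average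
of the Padé bound for `(1 + u t) ^ (-l)` over the Beta distribution; Jensen's inequality for
the size-biased distribution, whose mean is `(b + 1) / (c + 1)`, evaluates the average. -/
theorem extGauss_neg_le {p q l b c u : ℝ} (hp : 0 ≤ p) (hq : 0 ≤ q) (hl0 : 0 < l) (hl1 : l ≤ 1)
    (hb : 0 < b) (hbc : b < c) (hu0 : 0 ≤ u) (hu1 : u < 1) :
    extGauss p q l b c (-u) ≤
      frakE p q * (1 - 2 * l * (b / c) * u / ((l + 1) * u * ((b + 1) / (c + 1)) + 2)) := by
  have hd : 0 < c - b := by linarith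
  have hc : 0 < c := by linarith
  have hB := extBeta_zero_pos hb hd
  rw [extGauss_eq_integral hp hq hl0 hb hbc (by rwa [abs_neg, abs_of_nonneg hu0]),
    div_le_iff₀ hB]
  set m : ℝ := (b + 1) / (c + 1) with hm
  have hm0 : 0 < m := by positivity
  set k : ℝ := (l + 1) * u with hk
  have hk0 : 0 ≤ k := by positivity
  set D := k * m + 2 with hD
  have hD0 : 0 < D := by positivity
  set W := betaWeight b (c - b) 0 0 with hW
  have hE : 0 ≤ frakE p q := (Real.exp_pos _).le
  have hi : ∀ n : ℕ, IntegrableOn (fun t => W t * t ^ n) (Ioo (0 : ℝ) 1) := fun n =>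
    integrableOn_betaWeight_mul hb hd le_rfl le_rfl (M := 1) (by fun_prop) fun t ht => by
      rw [abs_pow, abs_of_pos ht.1]; exact pow_le_one₀ ht.1.le ht.2.le
  have hm1 : ∫ t in Ioo (0 : ℝ) 1, W t * t ^ 1 = b / c * extBeta b (c - b) 0 0 := by
    rw [hW, setIntegral_betaWeight_zero_mul_pow, Nat.cast_one, extBeta_zero_add_one hb hd]
    simp
  have hm2 : ∫ t in Ioo (0 : ℝ) 1, W t * t ^ 2 = m * (b / c) * extBeta b (c - b) 0 0 := by
    rw [hW, setIntegral_betaWeight_zero_mul_pow, show b + ((2 : ℕ) : ℝ) = b + 1 + 1 by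
      push_cast; ring, extBeta_zero_add_one (by linarith) hd, extBeta_zero_add_one hb hd]
    rw [show b + 1 + (c - b) = c + 1 by ring, add_sub_cancel]; ring
  have hm0' : ∫ t in Ioo (0 : ℝ) 1, W t = extBeta b (c - b) 0 0 :=
    (extBeta_eq_setIntegral _ _ _ _).symm
  have hi0 : IntegrableOn W (Ioo (0 : ℝ) 1) := integrableOn_betaWeight_zero hb hd
  have hi1 : IntegrableOn (fun t => W t - 2 * l * u * (1 / D + k * m / D ^ 2) * (W t * t ^ 1))
      (Ioo (0 : ℝ) 1) := hi0.sub ((hi 1).const_mul _)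
  calc ∫ t in Ioo (0 : ℝ) 1, betaWeight b (c - b) p q t * (1 - -u * t) ^ (-l)
      ≤ ∫ t in Ioo (0 : ℝ) 1, frakE p q * (W t - 2 * l * u * (1 / D + k * m / D ^ 2) * (W t * t ^ 1)
          + 2 * l * u * (k / D ^ 2) * (W t * t ^ 2)) := by
        refine setIntegral_mono_on (integrableOn_betaWeight_mul hb hd hp hq
          (continuousOn_one_sub_mul_rpow hu0) fun t ht => abs_one_sub_mul_rpow_neg_le hl0.le hu0 ht)
          ((hi1.add ((hi 2).const_mul _)).const_mul _)
          measurableSet_Ioo fun t ht => ?_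
        have hut : 0 ≤ u * t := mul_nonneg hu0 ht.1.le
        have h1 := one_add_rpow_neg_le hl0 hl1 hut
        have h2 := one_div_ge_tangent hk0 hm0.le ht.1.le
        have h3 : (1 - -u * t) ^ (-l) ≤
            1 - 2 * l * u * t * (1 / D - k * (t - m) / D ^ 2) := by
          rw [show 1 - -u * t = 1 + u * t by ring]
          refine h1.trans ?_
          have := mul_le_mul_of_nonneg_left h2 (show 0 ≤ 2 * l * u * t by
            have := ht.1; positivity)
          have e : 2 * l * (u * t) / ((l + 1) * (u * t) + 2) =
              2 * l * u * t * (1 / (k * t + 2)) := by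
            rw [hk]; ring
          rw [e]; linarith
        have hw0 : 0 < W t := betaWeight_pos ht
        have h4 : 0 ≤ (1 - -u * t) ^ (-l) := by
          apply Real.rpow_nonneg; linarith
        calc betaWeight b (c - b) p q t * (1 - -u * t) ^ (-l)
            ≤ frakE p q * W t * (1 - -u * t) ^ (-l) :=
              mul_le_mul_of_nonneg_right (betaWeight_le hp hq ht) h4
          _ ≤ frakE p q * W t * (1 - 2 * l * u * t * (1 / D - k * (t - m) / D ^ 2)) :=
              mul_le_mul_of_nonneg_left h3 (by positivity)
          _ = _ := by ring
    _ = _ := by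
        rw [integral_const_mul, integral_add hi1 ((hi 2).const_mul _),
          integral_sub hi0 ((hi 1).const_mul _), integral_const_mul, integral_const_mul, hm1, hm2,
          hm0']
        ring

/-! ### The Mathieu term as a function of `a n` -/

/-- Euler's integral for the Mathieu term at `a n = y`. In this form every factor decreases in `y`,
which is not visible from the series. -/
theorem extGauss_div_eq_integral {p q l eta b c r y : ℝ} (hp : 0 ≤ p) (hq : 0 ≤ q) (hl : 0 < l)
    (hb : 0 < b) (hbc : b < c) (hy : r ^ 2 < y) :
    extGauss p q l b c (-r ^ 2 / y) / (y ^ l * (y + r ^ 2) ^ eta) =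
      (∫ t in Ioo (0 : ℝ) 1, betaWeight b (c - b) p q t * (y + r ^ 2 * t) ^ (-l))
        / extBeta b (c - b) 0 0 * (y + r ^ 2) ^ (-eta) := by
  have hy0 : 0 < y := (sq_nonneg r).trans_lt hy
  have hz : |-r ^ 2 / y| < 1 := by
    rw [abs_div, abs_neg, abs_of_nonneg (sq_nonneg r), abs_of_pos hy0, div_lt_one hy0]
    exact hy
  rw [extGauss_eq_integral hp hq hl hb hbc hz, Real.rpow_neg (by positivity)]
  have : ∫ t in Ioo (0 : ℝ) 1, betaWeight b (c - b) p q t * (y + r ^ 2 * t) ^ (-l) =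
      y ^ (-l) *
        ∫ t in Ioo (0 : ℝ) 1, betaWeight b (c - b) p q t * (1 - -r ^ 2 / y * t) ^ (-l) := by
    rw [← integral_const_mul]
    refine setIntegral_congr_fun measurableSet_Ioo fun t ht => ?_
    have ht := ht.1
    have : y + r ^ 2 * t = y * (1 - -r ^ 2 / y * t) := by field_simp; ring
    rw [this, Real.mul_rpow hy0.le]
    · ring
    · rw [neg_div, neg_mul, sub_neg_eq_add]; positivity
  rw [this, Real.rpow_neg hy0.le]
  have := Real.rpow_pos_of_pos hy0 l
  field_simp

theorem integrableOn_betaWeight_mul_add_rpow {p q l b c r y : ℝ} (hp : 0 ≤ p) (hq : 0 ≤ q)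
    (hl : 0 < l) (hb : 0 < b) (hbc : b < c) (hy : 0 < y) :
    IntegrableOn (fun t => betaWeight b (c - b) p q t * (y + r ^ 2 * t) ^ (-l))
      (Ioo (0 : ℝ) 1) := by
  refine integrableOn_betaWeight_mul hb (by linarith) hp hq (M := y ^ (-l)) ?_ ?_
  · intro t ht
    have := ht.1
    have : y + r ^ 2 * t ≠ 0 := by positivity
    apply ContinuousAt.continuousWithinAt
    fun_prop (disch := exact Or.inl this)
  · intro t ht
    have := ht.1
    rw [abs_of_nonneg (by positivity)]
    exact Real.rpow_le_rpow_of_nonpos hy (by nlinarith [sq_nonneg r]) (by linarith)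

theorem extGauss_div_nonneg {p q l eta b c r y : ℝ} (hp : 0 ≤ p) (hq : 0 ≤ q) (hl : 0 < l)
    (hb : 0 < b) (hbc : b < c) (hy : r ^ 2 < y) :
    0 ≤ extGauss p q l b c (-r ^ 2 / y) / (y ^ l * (y + r ^ 2) ^ eta) := by
  have hy0 : 0 < y := (sq_nonneg r).trans_lt hy
  rw [extGauss_div_eq_integral hp hq hl hb hbc hy]
  have hB := extBeta_zero_pos hb (sub_pos.mpr hbc)
  have : 0 ≤ ∫ t in Ioo (0 : ℝ) 1, betaWeight b (c - b) p q t * (y + r ^ 2 * t) ^ (-l) :=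
    setIntegral_nonneg measurableSet_Ioo fun t ht => by
      have := ht.1
      have := (betaWeight_pos (x := b) (y := c - b) (p := p) (q := q) ht)
      positivity
  positivity

theorem extGauss_div_antitoneOn {p q l eta b c r : ℝ} (hp : 0 ≤ p) (hq : 0 ≤ q) (hl : 0 < l)
    (heta : 0 < eta) (hb : 0 < b) (hbc : b < c) :
    AntitoneOn (fun y => extGauss p q l b c (-r ^ 2 / y) / (y ^ l * (y + r ^ 2) ^ eta))
      (Ioi (r ^ 2)) := by
  intro y hy y' hy' hyy
  have hy : r ^ 2 < y := hy
  have hy0 : 0 < y := (sq_nonneg r).trans_lt hy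
  simp only
  rw [extGauss_div_eq_integral hp hq hl hb hbc hy, extGauss_div_eq_integral hp hq hl hb hbc hy']
  have hB := extBeta_zero_pos hb (sub_pos.mpr hbc)
  refine mul_le_mul (div_le_div_of_nonneg_right ?_ hB.le) ?_ ?_ ?_
  · refine setIntegral_mono_on
      (integrableOn_betaWeight_mul_add_rpow hp hq hl hb hbc (hy0.trans_le hyy))
      (integrableOn_betaWeight_mul_add_rpow hp hq hl hb hbc hy0) measurableSet_Ioo fun t ht => ?_
    have := ht.1
    refine mul_le_mul_of_nonneg_left ?_ (betaWeight_pos ht).le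
    exact Real.rpow_le_rpow_of_nonpos (by positivity) (by linarith) (by linarith)
  · exact Real.rpow_le_rpow_of_nonpos (by positivity) (by linarith) (by linarith)
  · have := hy0.trans_le hyy
    positivity
  · refine div_nonneg (setIntegral_nonneg measurableSet_Ioo fun t ht => ?_) hB.le
    have := ht.1
    have := (betaWeight_pos (x := b) (y := c - b) (p := p) (q := q) ht)
    positivity

/-! ### The affine majorants -/

/-- The constant term of Luke's rational bound for `₂F₁(α, b; c; -r ^ 2 / x)`: its limit as
`x → 0`. -/
noncomputable def lukeConst (α b c : ℝ) : ℝ :=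
  1 - 2 * α * b * (c + 1) / (c * (α + 1) * (b + 1))

/-- The slope of the affine majorant on `[y, ∞)` of Luke's rational bound at `-r ^ 2 / x`: that
bound is `lukeConst α b c + lukeSlope α b c r x * x`, and freezing the denominator at `y ≤ x`
increases the second term. -/
noncomputable def lukeSlope (α b c r y : ℝ) : ℝ :=
  4 * α * b * (c + 1) ^ 2 / (c * (α + 1) * (b + 1) * ((α + 1) * (b + 1) * r ^ 2 + 2 * (c + 1) * y))

theorem lukeConst_eq (α b c : ℝ) :
    lukeConst α b c = 1 - 2 * α / (α + 1) * (b * (c + 1) / (c * (b + 1))) := by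
  rw [lukeConst, div_mul_div_comm]; ring_nf

theorem lukeSlope_mul (α b c r y x : ℝ) :
    lukeSlope α b c r y * x = 2 * α / (α + 1) * (b * (c + 1) / (c * (b + 1))) *
      (2 * (c + 1) * x / ((α + 1) * (b + 1) * r ^ 2 + 2 * (c + 1) * y)) := by
  rw [lukeSlope, div_mul_div_comm, div_mul_div_comm, div_mul_eq_mul_div]
  congr 1 <;> ring_nf

theorem lukeSlope_nonneg {α b c r y : ℝ} (hα : 0 ≤ α) (hb : 0 < b) (hbc : b < c) (hy : 0 < y) :
    0 ≤ lukeSlope α b c r y := by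
  have : 0 < c := hb.trans hbc
  unfold lukeSlope; positivity

/-- A lower bound independent of `r`: `2 / (α + 3)` is the value of the last factor of
`lukeSlope_mul` in the extreme case `(b + 1) r ^ 2 = (c + 1) y`. -/
theorem lukeSlope_mul_ge {α b c r y : ℝ} (hα : 0 ≤ α) (hb : 0 < b) (hbc : b < c) (hy : 0 < y)
    (hr : r ^ 2 ≤ y) :
    2 * α / (α + 1) * (b * (c + 1) / (c * (b + 1))) * (2 / (α + 3)) ≤ lukeSlope α b c r y * y := by
  have : 0 < c := hb.trans hbc
  rw [lukeSlope_mul]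
  refine mul_le_mul_of_nonneg_left ?_ (by positivity)
  rw [div_le_div_iff₀ (by positivity) (by positivity)]
  have h1 : (b + 1) * r ^ 2 ≤ (c + 1) * y := by gcongr
  nlinarith

theorem luke_nonneg {α b c r y x : ℝ} (hα : 0 ≤ α) (hα3 : α ≤ 3) (hb : 0 < b) (hbc : b < c)
    (hy : 0 < y) (hr : r ^ 2 ≤ y) (hx : y ≤ x) :
    0 ≤ lukeConst α b c + lukeSlope α b c r y * x := by
  have hc : 0 < c := hb.trans hbc
  have h1 := lukeSlope_mul_ge hα hb hbc hy hr
  have h2 := mul_le_mul_of_nonneg_left hx (lukeSlope_nonneg (r := r) hα hb hbc hy)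
  have h3 : b * (c + 1) / (c * (b + 1)) ≤ 1 := by
    rw [div_le_one (by positivity)]; linarith
  have h4 : 2 * α / (α + 1) * (b * (c + 1) / (c * (b + 1)))
      - 2 * α / (α + 1) * (b * (c + 1) / (c * (b + 1))) * (2 / (α + 3))
      = 2 * α / (α + 3) * (b * (c + 1) / (c * (b + 1))) := by
    field_simp; ring
  have h5 : 2 * α / (α + 3) ≤ 1 := by rw [div_le_one (by positivity)]; linarith
  have h6 : 2 * α / (α + 3) * (b * (c + 1) / (c * (b + 1))) ≤ 1 :=
    mul_le_one₀ h5 (by positivity) h3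
  rw [lukeConst_eq]
  linarith

/-- The inequality that replaces Luke's bound at the parameter `l + 1`. With `A₁ + K₁ x` and
`A₂ + K₂ x` the affine majorants at `l + 1` and `l`, it says that `l (A₁ + K₁ x)` exceeds
`l (A₂ + K₂ x) - K₂ x`, which is what differentiating `x ^ (-l) (A₂ + K₂ x)` produces. -/
theorem luke_comparison {l b c r y x : ℝ} (hl0 : 0 < l) (hl1 : l ≤ 1) (hb : 0 < b) (hbc : b < c)
    (hy : 0 < y) (hr : r ^ 2 ≤ y) (hx : y ≤ x) :
    0 ≤ l * ((lukeConst (l + 1) b c + lukeSlope (l + 1) b c r y * x)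
      - (lukeConst l b c + lukeSlope l b c r y * x)) + lukeSlope l b c r y * x := by
  have hc : 0 < c := hb.trans hbc
  have h1 := lukeSlope_mul_ge (α := l + 1) (by linarith) hb hbc hy hr
  have h2 := lukeSlope_mul_ge hl0.le hb hbc hy hr
  have k1 := mul_le_mul_of_nonneg_left hx
    (lukeSlope_nonneg (α := l + 1) (r := r) (by linarith) hb hbc hy)
  have k2 := mul_le_mul_of_nonneg_left hx (lukeSlope_nonneg (r := r) hl0.le hb hbc hy)
  rw [lukeConst_eq, lukeConst_eq]
  set β := b * (c + 1) / (c * (b + 1)) with hβ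
  have hβ0 : 0 < β := by positivity
  have m1 := mul_le_mul_of_nonneg_left (h1.trans k1) hl0.le
  have m2 := mul_le_mul_of_nonneg_left (h2.trans k2) (sub_nonneg.mpr hl1)
  have e : l * ((1 - 2 * (l + 1) / (l + 1 + 1) * β) - (1 - 2 * l / (l + 1) * β))
      + l * (2 * (l + 1) / (l + 1 + 1) * β * (2 / (l + 1 + 3)))
      + (1 - l) * (2 * l / (l + 1) * β * (2 / (l + 3)))
      = 2 * l * β * (10 + 3 * l - l ^ 2) / ((l + 1) * (l + 2) * (l + 3) * (l + 4)) := by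
    have : l + 1 + 1 = l + 2 := by ring
    have : l + 1 + 3 = l + 4 := by ring
    simp only [*]
    field_simp; ring
  have : 0 ≤ 10 + 3 * l - l ^ 2 := by nlinarith
  have h0 : 0 ≤ 2 * l * β * (10 + 3 * l - l ^ 2) / ((l + 1) * (l + 2) * (l + 3) * (l + 4)) := by
    positivity
  linarith

theorem extGauss_le_luke {p q l b c r y x : ℝ} (hp : 0 ≤ p) (hq : 0 ≤ q) (hl0 : 0 < l)
    (hl1 : l ≤ 1) (hb : 0 < b) (hbc : b < c) (hy : 0 < y) (hr : r ^ 2 < y) (hx : y ≤ x) :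
    extGauss p q l b c (-r ^ 2 / x) ≤
      frakE p q * (lukeConst l b c + lukeSlope l b c r y * x) := by
  have hc : 0 < c := hb.trans hbc
  have hx0 : 0 < x := hy.trans_le hx
  rw [neg_div]
  refine (extGauss_neg_le hp hq hl0 hl1 hb hbc (by positivity)
    (by rw [div_lt_one hx0]; linarith)).trans ?_
  refine mul_le_mul_of_nonneg_left ?_ (Real.exp_pos _).le
  rw [lukeConst_eq, lukeSlope_mul]
  have h1 : 2 * (c + 1) * x / ((l + 1) * (b + 1) * r ^ 2 + 2 * (c + 1) * x) ≤
      2 * (c + 1) * x / ((l + 1) * (b + 1) * r ^ 2 + 2 * (c + 1) * y) := by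
    gcongr
  have h2 := mul_le_mul_of_nonneg_left h1
    (show 0 ≤ 2 * l / (l + 1) * (b * (c + 1) / (c * (b + 1))) by positivity)
  have e : 1 - 2 * l * (b / c) * (r ^ 2 / x) / ((l + 1) * (r ^ 2 / x) * ((b + 1) / (c + 1)) + 2)
      = 1 - 2 * l / (l + 1) * (b * (c + 1) / (c * (b + 1))) +
        2 * l / (l + 1) * (b * (c + 1) / (c * (b + 1))) *
        (2 * (c + 1) * x / ((l + 1) * (b + 1) * r ^ 2 + 2 * (c + 1) * x)) := by
    have e1 : (l + 1) * (r ^ 2 / x) * ((b + 1) / (c + 1)) + 2 =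
        ((l + 1) * (b + 1) * r ^ 2 + 2 * (c + 1) * x) / (x * (c + 1)) := by
      field_simp
    rw [e1]
    have : 0 < (l + 1) * (b + 1) * r ^ 2 + 2 * (c + 1) * x := by positivity
    field_simp
    ring
  linarith

/-! ### The kernel of the integrals -/

/-- The kernel `1 / (x ^ s * (x + r ^ 2) ^ t)` of the integral `𝒰_a(s, t)`. -/
noncomputable def mathieuKernel (r s t x : ℝ) : ℝ := 1 / (x ^ s * (x + r ^ 2) ^ t)

theorem mathieuKernel_pos {r s t x : ℝ} (hx : 0 < x) : 0 < mathieuKernel r s t x := by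
  unfold mathieuKernel; positivity

theorem mathieuKernel_eq_rpow {r s t x : ℝ} (hx : 0 < x) :
    mathieuKernel r s t x = x ^ (-s) * (x + r ^ 2) ^ (-t) := by
  rw [mathieuKernel, Real.rpow_neg hx.le, Real.rpow_neg (by positivity), one_div, mul_inv]

theorem mathieuKernel_mul_self {r s t x : ℝ} (hx : 0 < x) :
    mathieuKernel r s t x * x = mathieuKernel r (s - 1) t x := by
  rw [mathieuKernel_eq_rpow hx, mathieuKernel_eq_rpow hx,
    show -(s - 1) = -s + 1 by ring, Real.rpow_add_one hx.ne']
  ring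

theorem continuousOn_mathieuKernel (r s t : ℝ) : ContinuousOn (mathieuKernel r s t) (Ioi 0) := by
  intro x hx
  have hx : 0 < x := hx
  have h1 : x ≠ 0 := hx.ne'
  have h2 : x + r ^ 2 ≠ 0 := by positivity
  have h3 : x ^ s * (x + r ^ 2) ^ t ≠ 0 := by positivity
  unfold mathieuKernel
  apply ContinuousAt.continuousWithinAt
  fun_prop (disch := first | assumption | exact Or.inl ‹_›)

theorem mathieuKernel_le_rpow {r s t x : ℝ} (hx : 0 < x) (ht : 0 ≤ t) :
    mathieuKernel r s t x ≤ x ^ (-(s + t)) := by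
  rw [mathieuKernel_eq_rpow hx, neg_add, Real.rpow_add hx]
  refine mul_le_mul_of_nonneg_left ?_ (by positivity)
  exact Real.rpow_le_rpow_of_nonpos hx (by nlinarith [sq_nonneg r]) (by linarith)

theorem aestronglyMeasurable_mathieuKernel (r s t : ℝ) {y : ℝ} (hy : 0 ≤ y) :
    AEStronglyMeasurable (mathieuKernel r s t) (volume.restrict (Ioi y)) :=
  ((continuousOn_mathieuKernel r s t).mono (Ioi_subset_Ioi hy)).aestronglyMeasurable
    measurableSet_Ioi

theorem integrableOn_mathieuKernel {r s t y : ℝ} (hy : 0 < y) (ht : 0 ≤ t) (hst : 1 < s + t) :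
    IntegrableOn (mathieuKernel r s t) (Ioi y) := by
  refine (integrableOn_Ioi_rpow_of_lt (a := -(s + t)) (by linarith) hy).mono'
    (aestronglyMeasurable_mathieuKernel r s t hy.le) ?_
  filter_upwards [ae_restrict_mem measurableSet_Ioi] with x hx
  have hx : 0 < x := hy.trans hx
  rw [Real.norm_of_nonneg (mathieuKernel_pos hx).le]
  exact mathieuKernel_le_rpow hx ht

theorem tendsto_mathieuKernel {r s t : ℝ} (ht : 0 ≤ t) (hst : 0 < s + t) :
    Tendsto (mathieuKernel r s t) atTop (𝓝 0) := by
  refine squeeze_zero' ?_ ?_ (tendsto_rpow_neg_atTop hst)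
  · filter_upwards [eventually_gt_atTop 0] with x hx using (mathieuKernel_pos hx).le
  · filter_upwards [eventually_gt_atTop 0] with x hx using mathieuKernel_le_rpow hx ht

theorem hasDerivAt_mathieuKernel {r s t x : ℝ} (hx : 0 < x) :
    HasDerivAt (mathieuKernel r s t)
      (-(s * mathieuKernel r (s + 1) t x + t * mathieuKernel r s (t + 1) x)) x := by
  have h2 : 0 < x + r ^ 2 := by positivity
  have d1 := (hasDerivAt_id x).rpow_const (p := -s) (Or.inl hx.ne')
  have d2 := ((hasDerivAt_id x).add_const (r ^ 2)).rpow_const (p := -t) (Or.inl h2.ne')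
  have := (d1.mul d2).congr_of_eventuallyEq (f₁ := mathieuKernel r s t) (by
    filter_upwards [eventually_gt_nhds hx] with z hz using mathieuKernel_eq_rpow hz)
  refine this.congr_deriv ?_
  rw [mathieuKernel_eq_rpow hx, mathieuKernel_eq_rpow hx, neg_add', neg_add']
  simp only [id]
  ring_nf

/-- The function `H x = mathieuKernel r l eta x * (A₂ + K₂ x)` tends to `0` at infinity, so `H y`
is the integral of `-H'` over `(y, ∞)`; the hypothesis `h` says that the integrand on the
right-hand side is at least `-H'`. -/
theorem mathieuKernel_mul_le_integral {r l eta A₁ K₁ A₂ K₂ y : ℝ} (hl : 0 < l) (heta : 0 < eta)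
    (h1 : 1 < l + eta) (hy : 0 < y)
    (h : ∀ x, y ≤ x → 0 ≤ l * ((A₁ + K₁ * x) - (A₂ + K₂ * x)) + K₂ * x) :
    mathieuKernel r l eta y * (A₂ + K₂ * y) ≤
      ∫ x in Ioi y, (l * (A₁ * mathieuKernel r (l + 1) eta x + K₁ * mathieuKernel r l eta x)
        + eta * (A₂ * mathieuKernel r l (eta + 1) x
          + K₂ * mathieuKernel r (l - 1) (eta + 1) x)) := by
  have i1 : IntegrableOn (mathieuKernel r (l + 1) eta) (Ioi y) :=
    integrableOn_mathieuKernel hy heta.le (by linarith)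
  have i2 : IntegrableOn (mathieuKernel r l eta) (Ioi y) :=
    integrableOn_mathieuKernel hy heta.le (by linarith)
  have i3 : IntegrableOn (mathieuKernel r l (eta + 1)) (Ioi y) :=
    integrableOn_mathieuKernel hy (by linarith) (by linarith)
  have i4 : IntegrableOn (mathieuKernel r (l - 1) (eta + 1)) (Ioi y) :=
    integrableOn_mathieuKernel hy (by linarith) (by linarith)
  set H' : ℝ → ℝ := fun x =>
      -(l * (A₂ * mathieuKernel r (l + 1) eta x + K₂ * mathieuKernel r l eta x)
        + eta * (A₂ * mathieuKernel r l (eta + 1) x + K₂ * mathieuKernel r (l - 1) (eta + 1) x)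
        - K₂ * mathieuKernel r l eta x) with hH'
  have iH : IntegrableOn H' (Ioi y) :=
    (((((i1.const_mul A₂).add (i2.const_mul K₂)).const_mul l).add
      (((i3.const_mul A₂).add (i4.const_mul K₂)).const_mul eta)).sub (i2.const_mul K₂)).neg
  have iD : IntegrableOn (fun x => l * (A₁ * mathieuKernel r (l + 1) eta x
        + K₁ * mathieuKernel r l eta x) + eta * (A₂ * mathieuKernel r l (eta + 1) x
        + K₂ * mathieuKernel r (l - 1) (eta + 1) x)) (Ioi y) :=
    (((i1.const_mul A₁).add (i2.const_mul K₁)).const_mul l).add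
      (((i3.const_mul A₂).add (i4.const_mul K₂)).const_mul eta)
  have e : ∀ x, 0 < x → mathieuKernel r (l + 1) eta x * x = mathieuKernel r l eta x :=
    fun x hx => by rw [mathieuKernel_mul_self hx, add_sub_cancel_right]
  have e' : ∀ x, 0 < x → mathieuKernel r l (eta + 1) x * x = mathieuKernel r (l - 1) (eta + 1) x :=
    fun x hx => mathieuKernel_mul_self hx
  have hd : ∀ x ∈ Ici y,
      HasDerivAt (fun x => mathieuKernel r l eta x * (A₂ + K₂ * x)) (H' x) x := by
    intro x hx
    have hx0 : 0 < x := hy.trans_le hx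
    refine ((hasDerivAt_mathieuKernel hx0).mul
      (((hasDerivAt_id x).const_mul K₂).const_add A₂)).congr_deriv ?_
    simp only [hH', id, ← e x hx0, ← e' x hx0]
    ring
  have hlim : Tendsto (fun x => mathieuKernel r l eta x * (A₂ + K₂ * x)) atTop (𝓝 0) := by
    have t1 := (tendsto_mathieuKernel (r := r) (s := l) heta.le (by linarith)).const_mul A₂
    have t2 := (tendsto_mathieuKernel (r := r) (s := l - 1) heta.le (by linarith)).const_mul K₂
    have := t1.add t2
    simp only [mul_zero, add_zero] at this
    refine this.congr' ?_
    filter_upwards [eventually_gt_atTop 0] with x hx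
    rw [← mathieuKernel_mul_self hx]; ring
  have hFTC := integral_Ioi_of_hasDerivAt_of_tendsto' hd iH hlim
  have : mathieuKernel r l eta y * (A₂ + K₂ * y) = ∫ x in Ioi y, -H' x := by
    rw [integral_neg, hFTC]; ring
  rw [this]
  refine setIntegral_mono_on iH.neg iD measurableSet_Ioi fun x hx => ?_
  have hx : y < x := hx
  have hx0 : 0 < x := hy.trans hx
  have := mul_nonneg (mathieuKernel_pos (r := r) (s := l + 1) (t := eta) hx0).le (h x hx.le)
  simp only [hH', ← e x hx0, ← e' x hx0]
  linarith

theorem ascPochhammer_eval_mul_add (A : ℝ) (n : ℕ) :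
    (ascPochhammer ℝ n).eval A * (A + n) = A * (ascPochhammer ℝ n).eval (A + 1) := by
  rw [← ascPochhammer_succ_eval, ascPochhammer_succ_left]
  simp

/-- The binomial series of `(1 + r ^ 2 / x) ^ (-t)` is integrated term by term; the factor
`1 / (A + n)` that results is `(A)ₙ / (A + 1)ₙ / A`. -/
theorem integral_mathieuKernel {r s t A y : ℝ} (ht : 0 < t) (hA : 0 < A) (hst : s + t = A + 1)
    (hy : r ^ 2 < y) :
    ∫ x in Ioi y, mathieuKernel r s t x =
      y ^ (-A) / A * ordinaryHypergeometric t A (A + 1) (-r ^ 2 / y) := by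
  have hy0 : 0 < y := (sq_nonneg r).trans_lt hy
  set k : ℕ → ℝ := fun n => (ascPochhammer ℝ n).eval t / (n.factorial : ℝ) with hk
  have hk0 : ∀ n, 0 ≤ k n := fun n => by
    have := ascPochhammer_pos n t ht
    positivity
  set F : ℕ → ℝ → ℝ := fun n x => k n * (-r ^ 2) ^ n * x ^ (-(A + 1) - n) with hF
  have hlt : ∀ n : ℕ, -(A + 1) - (n : ℝ) < -1 := fun n => by
    have : (0 : ℝ) ≤ n := n.cast_nonneg
    linarith
  have hi : ∀ n : ℕ, IntegrableOn (fun x : ℝ => x ^ (-(A + 1) - n)) (Ioi y) := fun n =>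
    integrableOn_Ioi_rpow_of_lt (hlt n) hy0
  have hI : ∀ n, Integrable (F n) (volume.restrict (Ioi y)) := fun n => (hi n).const_mul _
  have hint : ∀ n : ℕ, ∫ x in Ioi y, x ^ (-(A + 1) - (n : ℝ)) = y ^ (-A) / y ^ n / (A + n) := by
    intro n
    rw [integral_Ioi_rpow_of_lt (hlt n) hy0, show -(A + 1) - (n : ℝ) + 1 = -(A + n) by ring,
      neg_div_neg_eq, neg_add, ← sub_eq_add_neg, Real.rpow_sub_natCast hy0.ne']
  have hS : Summable fun n => ∫ x in Ioi y, ‖F n x‖ := by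
    have h1 : Summable fun n => k n * (r ^ 2 / y) ^ n * (y ^ (-A) / A) := by
      apply Summable.mul_right
      refine (hasSum_ascPochhammer_pow t (x := r ^ 2 / y) ?_).summable.congr fun n => ?_
      · rw [abs_of_nonneg (by positivity), div_lt_one hy0]; exact hy
      · simp only [hk]; ring
    refine h1.of_nonneg_of_le (fun n => by positivity) fun n => ?_
    have e : ∫ x in Ioi y, ‖F n x‖ = k n * (r ^ 2) ^ n * (y ^ (-A) / y ^ n / (A + n)) := by
      rw [← hint, ← integral_const_mul]
      refine setIntegral_congr_fun measurableSet_Ioi fun x hx => ?_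
      have hx0 : 0 < x := hy0.trans hx
      simp only [hF, norm_mul, norm_pow, norm_neg]
      rw [Real.norm_of_nonneg (hk0 n), Real.norm_eq_abs r, sq_abs,
        Real.norm_of_nonneg (by positivity)]
    rw [e]
    have : k n * (r ^ 2) ^ n * (y ^ (-A) / y ^ n / (A + n)) =
        k n * (r ^ 2 / y) ^ n * (y ^ (-A) / (A + n)) := by
      rw [div_pow]; ring
    rw [this]
    have := hk0 n
    gcongr
    linarith [(n.cast_nonneg : (0 : ℝ) ≤ n)]
  have hsum := hasSum_integral_of_summable_integral_norm hI hS
  have e2 : ∫ x in Ioi y, ∑' n, F n x = ∫ x in Ioi y, mathieuKernel r s t x := by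
    refine setIntegral_congr_fun measurableSet_Ioi fun x hx => ?_
    have hyx : y < x := hx
    have hx0 : 0 < x := hy0.trans hx
    have hz : |-r ^ 2 / x| < 1 := by
      rw [abs_div, abs_neg, abs_of_nonneg (sq_nonneg r), abs_of_pos hx0, div_lt_one hx0]
      linarith
    have h1 := (hasSum_ascPochhammer_pow t hz).mul_left (x ^ (-(A + 1)))
    have e3 : x ^ (-(A + 1)) * (1 - -r ^ 2 / x) ^ (-t) = mathieuKernel r s t x := by
      have : x + r ^ 2 = x * (1 - -r ^ 2 / x) := by field_simp; ring
      rw [mathieuKernel_eq_rpow hx0, this, Real.mul_rpow hx0.le, ← mul_assoc, ← Real.rpow_add hx0]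
      · congr 2; linarith
      · rw [neg_div, sub_neg_eq_add]; positivity
    rw [← e3, ← h1.tsum_eq]
    refine tsum_congr fun n => ?_
    simp only [hF, hk]
    rw [Real.rpow_sub_natCast hx0.ne', div_pow]; ring
  rw [e2] at hsum
  rw [← hsum.tsum_eq, ordinaryHypergeometric_eq_tsum, ← tsum_mul_left]
  refine tsum_congr fun n => ?_
  have hP := ascPochhammer_eval_mul_add A n
  have hP0 := ascPochhammer_pos n (A + 1) (by linarith)
  have hAn : 0 < A + n := by positivity
  simp only [hF, smul_eq_mul]
  rw [integral_const_mul, hint, eq_div_of_mul_eq hAn.ne' hP]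
  simp only [hk]
  rw [div_pow]
  field_simp

/-! ### The integral majorant of the Mathieu terms -/

/-- The integrand of the upper bounds, without the weight `⌊a⁻¹ x⌋` and the factor `frakE p q`. It
is minus the derivative of the Mathieu term, with the hypergeometric functions at `l + 1` and `l`
replaced by the affine majorants based at `y`; the powers of `x` are absorbed in the kernels. -/
noncomputable def mathieuMajorant (l eta b c r y x : ℝ) : ℝ :=
  l * (lukeConst (l + 1) b c * mathieuKernel r (l + 1) eta x
      + lukeSlope (l + 1) b c r y * mathieuKernel r l eta x)
    + eta * (lukeConst l b c * mathieuKernel r l (eta + 1) x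
      + lukeSlope l b c r y * mathieuKernel r (l - 1) (eta + 1) x)

theorem mathieuMajorant_nonneg {l eta b c r y x : ℝ} (hl0 : 0 < l) (hl1 : l ≤ 1) (heta : 0 < eta)
    (hb : 0 < b) (hbc : b < c) (hy : 0 < y) (hr : r ^ 2 ≤ y) (hx : y ≤ x) :
    0 ≤ mathieuMajorant l eta b c r y x := by
  have hx0 : 0 < x := hy.trans_le hx
  have h1 := mul_nonneg (mathieuKernel_pos (r := r) (s := l + 1) (t := eta) hx0).le
    (luke_nonneg (α := l + 1) (by linarith) (by linarith) hb hbc hy hr hx)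
  have h2 := mul_nonneg (mathieuKernel_pos (r := r) (s := l) (t := eta + 1) hx0).le
    (luke_nonneg hl0.le (by linarith) hb hbc hy hr hx)
  have e1 : mathieuKernel r l eta x = mathieuKernel r (l + 1) eta x * x := by
    rw [mathieuKernel_mul_self hx0, add_sub_cancel_right]
  rw [mathieuMajorant, e1, ← mathieuKernel_mul_self (s := l) hx0]
  have h3 := mul_nonneg hl0.le h1
  have h4 := mul_nonneg heta.le h2
  linarith

/-- Linearity of the integral for the shape of combination that occurs in the bounds. -/
theorem integral_linear_combination {X : Type*} [MeasurableSpace X] {μ : Measure X}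
    {f₁ f₂ f₃ f₄ : X → ℝ} (h₁ : Integrable f₁ μ) (h₂ : Integrable f₂ μ) (h₃ : Integrable f₃ μ)
    (h₄ : Integrable f₄ μ) (k m A₁ K₁ A₂ K₂ : ℝ) :
    Integrable (fun x => k * (A₁ * f₁ x + K₁ * f₂ x) + m * (A₂ * f₃ x + K₂ * f₄ x)) μ ∧
    ∫ x, (k * (A₁ * f₁ x + K₁ * f₂ x) + m * (A₂ * f₃ x + K₂ * f₄ x)) ∂μ =
      k * (A₁ * ∫ x, f₁ x ∂μ + K₁ * ∫ x, f₂ x ∂μ)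
        + m * (A₂ * ∫ x, f₃ x ∂μ + K₂ * ∫ x, f₄ x ∂μ) := by
  have i₁ : Integrable (fun x => k * (A₁ * f₁ x + K₁ * f₂ x)) μ :=
    ((h₁.const_mul A₁).add (h₂.const_mul K₁)).const_mul k
  have i₂ : Integrable (fun x => m * (A₂ * f₃ x + K₂ * f₄ x)) μ :=
    ((h₃.const_mul A₂).add (h₄.const_mul K₂)).const_mul m
  refine ⟨i₁.add i₂, ?_⟩
  rw [integral_add i₁ i₂, integral_const_mul, integral_const_mul,
    integral_add (h₁.const_mul _) (h₂.const_mul _), integral_add (h₃.const_mul _) (h₄.const_mul _),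
    integral_const_mul, integral_const_mul, integral_const_mul, integral_const_mul]

theorem integrableOn_mathieuMajorant {l eta b c r y z : ℝ} (heta : 0 < eta) (h1 : 1 < l + eta)
    (hz : 0 < z) : IntegrableOn (mathieuMajorant l eta b c r y) (Ioi z) :=
  (integral_linear_combination (integrableOn_mathieuKernel hz heta.le (by linarith))
    (integrableOn_mathieuKernel hz heta.le (by linarith))
    (integrableOn_mathieuKernel hz (by linarith) (by linarith))
    (integrableOn_mathieuKernel hz (by linarith) (by linarith)) _ _ _ _ _ _).1

/-- The central estimate: each Mathieu term is at most a tail of the integral of the majorant. The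
integrands cannot in general be compared pointwise, because Luke's bound can fail at the parameter
`l + 1`. -/
theorem extGauss_div_le_integral {p q l eta b c r y z : ℝ} (hp : 0 ≤ p) (hq : 0 ≤ q)
    (hl0 : 0 < l) (hl1 : l ≤ 1) (heta : 0 < eta) (h1 : 1 < l + eta) (hb : 0 < b) (hbc : b < c)
    (hr : r ^ 2 < y) (hz : y ≤ z) :
    extGauss p q l b c (-r ^ 2 / z) / (z ^ l * (z + r ^ 2) ^ eta) ≤
      frakE p q * ∫ x in Ioi z, mathieuMajorant l eta b c r y x := by
  have hy : 0 < y := (sq_nonneg r).trans_lt hr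
  have hz0 : 0 < z := hy.trans_le hz
  have hE : 0 ≤ frakE p q := (Real.exp_pos _).le
  calc extGauss p q l b c (-r ^ 2 / z) / (z ^ l * (z + r ^ 2) ^ eta)
      = mathieuKernel r l eta z * extGauss p q l b c (-r ^ 2 / z) := by
        rw [mathieuKernel]; ring
    _ ≤ mathieuKernel r l eta z * (frakE p q * (lukeConst l b c + lukeSlope l b c r y * z)) :=
        mul_le_mul_of_nonneg_left (extGauss_le_luke hp hq hl0 hl1 hb hbc hy hr hz)
          (mathieuKernel_pos hz0).le
    _ = frakE p q * (mathieuKernel r l eta z * (lukeConst l b c + lukeSlope l b c r y * z)) := by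
        ring
    _ ≤ _ := mul_le_mul_of_nonneg_left (mathieuKernel_mul_le_integral hl0 heta h1 hz0
          fun x hx => luke_comparison hl0 hl1 hb hbc hy hr.le (hz.trans hx)) hE

/-! ### The counting function and the convergence of the integrals -/

theorem natCast_le_floor_invPos {a : ℝ → ℝ} (ha_mono : StrictMonoOn a (Ioi 0))
    (ha_surj : SurjOn a (Ioi 0) (Ici (a 1))) {x : ℝ} (hx : a 1 ≤ x) {n : ℕ} (hn : 0 < n)
    (h : a n ≤ x) : (n : ℤ) ≤ ⌊invPos a x⌋ := by
  have hmem : x ∈ a '' Ioi 0 := ha_surj hx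
  have h1 : invPos a x ∈ Ioi 0 := Function.invFunOn_mem hmem
  have h2 : a (invPos a x) = x := Function.invFunOn_eq hmem
  rw [Int.le_floor, Int.cast_natCast]
  have hn' : (n : ℝ) ∈ Ioi (0 : ℝ) := by simpa using hn
  rw [← ha_mono.le_iff_le hn' h1, h2]
  exact h

theorem sum_indicator_le_floor_invPos {a : ℝ → ℝ} (ha_mono : StrictMonoOn a (Ioi 0))
    (ha_surj : SurjOn a (Ioi 0) (Ici (a 1))) {x : ℝ} (hx : a 1 ≤ x) (N : ℕ) :
    ∑ i ∈ Finset.range N, (Ioi (a ((i + 1 : ℕ) : ℝ))).indicator (1 : ℝ → ℝ) x ≤ ⌊invPos a x⌋ := by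
  classical
  have h1 : (1 : ℤ) ≤ ⌊invPos a x⌋ := by
    simpa using natCast_le_floor_invPos ha_mono ha_surj hx one_pos (by simpa using hx)
  obtain ⟨k, hk⟩ := Int.eq_ofNat_of_zero_le (show 0 ≤ ⌊invPos a x⌋ by linarith)
  have hsub : (Finset.range N).filter (fun i => x ∈ Ioi (a ((i + 1 : ℕ) : ℝ))) ⊆
      Finset.range k := by
    intro i hi
    have := natCast_le_floor_invPos ha_mono ha_surj hx i.succ_pos
      (le_of_lt (Finset.mem_filter.mp hi).2)
    rw [hk] at this
    rw [Finset.mem_range]; omega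
  have hcard := Finset.card_le_card hsub
  rw [Finset.card_range] at hcard
  simp only [Set.indicator_apply, Pi.one_apply, Finset.sum_boole, hk]
  exact_mod_cast hcard

theorem one_le_floor_invPos {a : ℝ → ℝ} (ha_mono : StrictMonoOn a (Ioi 0))
    (ha_surj : SurjOn a (Ioi 0) (Ici (a 1))) {x : ℝ} (hx : a 1 ≤ x) :
    (1 : ℝ) ≤ ⌊invPos a x⌋ := by
  exact_mod_cast natCast_le_floor_invPos ha_mono ha_surj hx one_pos (by simpa using hx)

theorem uIntegrand_eq (a : ℝ → ℝ) (r s t x : ℝ) :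
    uIntegrand a r s t x = ⌊invPos a x⌋ * mathieuKernel r s t x := by
  rw [uIntegrand, mathieuKernel, mul_one_div]

/-- Convergence of `𝒰_a` passes to a kernel that is a bounded continuous multiple. -/
theorem UConverges.of_mul_bounded {a : ℝ → ℝ} {r s t s' t' M : ℝ} {f : ℝ → ℝ}
    (h : UConverges a r s t) (ha : 0 < a 1) (hf : ContinuousOn f (Ioi 0))
    (hM : ∀ x, a 1 < x → |f x| ≤ M)
    (hs : ∀ x, 0 < x → mathieuKernel r s' t' x = mathieuKernel r s t x * f x) :
    UConverges a r s' t' := by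
  refine (Integrable.mul_bdd (c := M) (f := uIntegrand a r s t) (g := f) h
    ((hf.mono (Ioi_subset_Ioi ha.le)).aestronglyMeasurable measurableSet_Ioi) ?_).congr ?_
  · filter_upwards [ae_restrict_mem measurableSet_Ioi] with x hx using hM x hx
  · filter_upwards [ae_restrict_mem measurableSet_Ioi] with x hx
    rw [uIntegrand_eq, uIntegrand_eq, hs x (ha.trans hx), mul_assoc]

theorem mathieuKernel_add_one_right {r s t x : ℝ} (hx : 0 < x) :
    mathieuKernel r s (t + 1) x = mathieuKernel r s t x * (x + r ^ 2)⁻¹ := by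
  have : 0 < x + r ^ 2 := by positivity
  rw [mathieuKernel, mathieuKernel, Real.rpow_add_one this.ne']
  field_simp

theorem UConverges.add_one_left {a : ℝ → ℝ} {r s t : ℝ} (h : UConverges a r s t) (ha : 0 < a 1) :
    UConverges a r (s + 1) t := by
  refine h.of_mul_bounded (f := fun x => x⁻¹) (M := (a 1)⁻¹) ha ?_ ?_ ?_
  · exact continuousOn_inv₀.mono fun x hx => ne_of_gt hx
  · intro x hx
    rw [abs_of_pos (inv_pos.mpr (ha.trans hx))]
    exact inv_anti₀ ha hx.le
  · intro x hx
    have := mathieuKernel_mul_self (r := r) (s := s + 1) (t := t) hx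
    rw [add_sub_cancel_right] at this
    rw [← this]; field_simp

theorem UConverges.add_one_right {a : ℝ → ℝ} {r s t : ℝ} (h : UConverges a r s t) (ha : 0 < a 1) :
    UConverges a r s (t + 1) := by
  refine h.of_mul_bounded (f := fun x => (x + r ^ 2)⁻¹) (M := (a 1)⁻¹) ha ?_ ?_ ?_
  · refine ContinuousOn.inv₀ (by fun_prop) fun x hx => ?_
    have hx : 0 < x := hx
    positivity
  · intro x hx
    have := ha.trans hx
    rw [abs_of_pos (by positivity)]
    exact inv_anti₀ ha (by nlinarith [sq_nonneg r])
  · exact fun x hx => mathieuKernel_add_one_right hx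

theorem UConverges.sub_one_add_one {a : ℝ → ℝ} {r s t : ℝ} (h : UConverges a r s t)
    (ha : 0 < a 1) : UConverges a r (s - 1) (t + 1) := by
  refine h.of_mul_bounded (f := fun x => (x + r ^ 2)⁻¹ * x) (M := 1) ha ?_ ?_ ?_
  · refine ContinuousOn.mul (ContinuousOn.inv₀ (by fun_prop) fun x hx => ?_) (by fun_prop)
    have hx : 0 < x := hx
    positivity
  · intro x hx
    have := ha.trans hx
    rw [abs_of_pos (by positivity), inv_mul_le_one₀ (by positivity)]
    nlinarith [sq_nonneg r]
  · intro x hx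
    rw [← mathieuKernel_mul_self hx, mathieuKernel_add_one_right hx, mul_assoc]

/-- Since the integer part of `a⁻¹` is at least `1` on `[a 1, ∞)`, the integral `𝒰_a(s, t)` can only
converge if `x ^ (-s - t)` is integrable at infinity. -/
theorem UConverges.one_lt_add {a : ℝ → ℝ} (ha_mono : StrictMonoOn a (Ioi 0))
    (ha_surj : SurjOn a (Ioi 0) (Ici (a 1))) {r s t : ℝ} (h : UConverges a r s t) (ha : 0 < a 1)
    (ht : 0 ≤ t) (hr : r ^ 2 ≤ a 1) : 1 < s + t := by
  have h1 : IntegrableOn (mathieuKernel r s t) (Ioi (a 1)) := by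
    refine Integrable.mono' (g := uIntegrand a r s t) h
      (aestronglyMeasurable_mathieuKernel r s t ha.le) ?_
    filter_upwards [ae_restrict_mem measurableSet_Ioi] with x hx
    have hx : a 1 < x := hx
    have hk := mathieuKernel_pos (r := r) (s := s) (t := t) (ha.trans hx)
    rw [Real.norm_of_nonneg hk.le, uIntegrand_eq]
    exact le_mul_of_one_le_left hk.le (one_le_floor_invPos ha_mono ha_surj hx.le)
  have h2 : IntegrableOn (fun x : ℝ => x ^ (-(s + t))) (Ioi (a 1)) := by
    refine Integrable.mono' (g := fun x => (2 : ℝ) ^ t * mathieuKernel r s t x) (h1.const_mul _)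
      (by fun_prop) ?_
    filter_upwards [ae_restrict_mem measurableSet_Ioi] with x hx
    have hx : a 1 < x := hx
    have hx0 : 0 < x := ha.trans hx
    rw [Real.norm_of_nonneg (by positivity), mathieuKernel_eq_rpow hx0, neg_add,
      Real.rpow_add hx0]
    have h3 : (2 * x) ^ (-t) ≤ (x + r ^ 2) ^ (-t) :=
      Real.rpow_le_rpow_of_nonpos (by positivity) (by linarith) (by linarith)
    rw [Real.mul_rpow (by norm_num) hx0.le, Real.rpow_neg (by norm_num : (0 : ℝ) ≤ 2)] at h3
    have h4 : (0 : ℝ) < 2 ^ t := by positivity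
    have h5 : x ^ (-t) ≤ 2 ^ t * (x + r ^ 2) ^ (-t) := by
      rw [inv_mul_le_iff₀ h4] at h3; exact h3
    have := mul_le_mul_of_nonneg_left h5 (show 0 ≤ x ^ (-s) by positivity)
    linarith
  rw [integrableOn_Ioi_rpow_iff ha] at h2
  linarith

/-! ### Evaluation of the bounds -/

theorem tendsto_extGauss_div {p q l eta b c r : ℝ} (hp : 0 ≤ p) (hq : 0 ≤ q) (hl0 : 0 < l)
    (hl1 : l ≤ 1) (heta : 0 < eta) (h1 : 1 < l + eta) (hb : 0 < b) (hbc : b < c) :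
    Tendsto (fun y => extGauss p q l b c (-r ^ 2 / y) / (y ^ l * (y + r ^ 2) ^ eta)) atTop
      (𝓝 0) := by
  set y : ℝ := r ^ 2 + 1 with hy
  have hy0 : 0 < y := by positivity
  have hr : r ^ 2 < y := by linarith
  have t1 := (tendsto_mathieuKernel (r := r) (s := l) heta.le (by linarith)).const_mul
    (frakE p q * lukeConst l b c)
  have t2 := (tendsto_mathieuKernel (r := r) (s := l - 1) heta.le (by linarith)).const_mul
    (frakE p q * lukeSlope l b c r y)
  have t := t1.add t2
  simp only [mul_zero, add_zero] at t
  refine squeeze_zero' ?_ ?_ t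
  · filter_upwards [eventually_gt_atTop (r ^ 2)] with x hx
    exact extGauss_div_nonneg hp hq hl0 hb hbc hx
  · filter_upwards [eventually_ge_atTop y] with x hx
    have hx0 : 0 < x := hy0.trans_le hx
    have := mul_le_mul_of_nonneg_left (extGauss_le_luke hp hq hl0 hl1 hb hbc hy0 hr hx)
      (mathieuKernel_pos (r := r) (s := l) (t := eta) hx0).le
    rw [← mathieuKernel_mul_self hx0]
    calc _ = mathieuKernel r l eta x * extGauss p q l b c (-r ^ 2 / x) := by
          rw [mathieuKernel]; ring
      _ ≤ _ := this
      _ = _ := by ring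

theorem integral_mathieuMajorant {l eta b c r y : ℝ} (heta : 0 < eta) (h1 : 1 < l + eta)
    (hr : r ^ 2 < y) :
    ∫ x in Ioi y, mathieuMajorant l eta b c r y x =
      l * (lukeConst (l + 1) b c * (y ^ (-(l + eta)) / (l + eta) *
            ordinaryHypergeometric eta (l + eta) (l + eta + 1) (-r ^ 2 / y))
          + lukeSlope (l + 1) b c r y * (y ^ (-(l + eta - 1)) / (l + eta - 1) *
            ordinaryHypergeometric eta (l + eta - 1) (l + eta) (-r ^ 2 / y)))
      + eta * (lukeConst l b c * (y ^ (-(l + eta)) / (l + eta) *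
            ordinaryHypergeometric (eta + 1) (l + eta) (l + eta + 1) (-r ^ 2 / y))
          + lukeSlope l b c r y * (y ^ (-(l + eta - 1)) / (l + eta - 1) *
            ordinaryHypergeometric (eta + 1) (l + eta - 1) (l + eta) (-r ^ 2 / y))) := by
  have hy : 0 < y := (sq_nonneg r).trans_lt hr
  have i1 : IntegrableOn (mathieuKernel r (l + 1) eta) (Ioi y) :=
    integrableOn_mathieuKernel hy heta.le (by linarith)
  have i2 : IntegrableOn (mathieuKernel r l eta) (Ioi y) :=
    integrableOn_mathieuKernel hy heta.le (by linarith)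
  have i3 : IntegrableOn (mathieuKernel r l (eta + 1)) (Ioi y) :=
    integrableOn_mathieuKernel hy (by linarith) (by linarith)
  have i4 : IntegrableOn (mathieuKernel r (l - 1) (eta + 1)) (Ioi y) :=
    integrableOn_mathieuKernel hy (by linarith) (by linarith)
  have j1 := integral_mathieuKernel (s := l + 1) (A := l + eta) heta (by linarith) (by ring) hr
  have j2 := integral_mathieuKernel (s := l) (A := l + eta - 1) heta (by linarith) (by ring) hr
  have j3 := integral_mathieuKernel (s := l) (t := eta + 1) (A := l + eta) (by linarith)
    (by linarith) (by ring) hr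
  have j4 := integral_mathieuKernel (s := l - 1) (t := eta + 1) (A := l + eta - 1) (by linarith)
    (by linarith) (by ring) hr
  rw [sub_add_cancel] at j2 j4
  simp only [mathieuMajorant]
  rw [(integral_linear_combination i1 i2 i3 i4 _ _ _ _ _ _).2, j1, j2, j3, j4]

theorem integral_floor_mul_mathieuMajorant {a : ℝ → ℝ} {l eta b c r y : ℝ}
    (h1 : UConverges a r (l + 1) eta) (h2 : UConverges a r l eta)
    (h3 : UConverges a r l (eta + 1)) (h4 : UConverges a r (l - 1) (eta + 1)) :
    IntegrableOn (fun x => ⌊invPos a x⌋ * mathieuMajorant l eta b c r y x) (Ioi (a 1)) ∧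
    ∫ x in Ioi (a 1), ⌊invPos a x⌋ * mathieuMajorant l eta b c r y x =
      l * (lukeConst (l + 1) b c * uInt a r (l + 1) eta
          + lukeSlope (l + 1) b c r y * uInt a r l eta)
      + eta * (lukeConst l b c * uInt a r l (eta + 1)
          + lukeSlope l b c r y * uInt a r (l - 1) (eta + 1)) := by
  unfold UConverges at h1 h2 h3 h4
  have e : (fun x => ⌊invPos a x⌋ * mathieuMajorant l eta b c r y x) = fun x =>
      l * (lukeConst (l + 1) b c * uIntegrand a r (l + 1) eta x
          + lukeSlope (l + 1) b c r y * uIntegrand a r l eta x)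
      + eta * (lukeConst l b c * uIntegrand a r l (eta + 1) x
          + lukeSlope l b c r y * uIntegrand a r (l - 1) (eta + 1) x) := by
    funext x
    simp only [uIntegrand_eq, mathieuMajorant]
    ring
  rw [e]
  exact integral_linear_combination h1 h2 h3 h4 _ _ _ _ _ _

/-- The tails of the integral of `D`, added over `n`, count `D x` once for each `n` with
`a n < x`. -/
theorem sum_integral_Ioi_le {a D : ℝ → ℝ} (ha_mono : StrictMonoOn a (Ioi 0))
    (ha_surj : SurjOn a (Ioi 0) (Ici (a 1))) (hD0 : ∀ x, a 1 ≤ x → 0 ≤ D x)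
    (hD : IntegrableOn D (Ioi (a 1)))
    (hN : IntegrableOn (fun x => ⌊invPos a x⌋ * D x) (Ioi (a 1))) (N : ℕ) :
    ∑ i ∈ Finset.range N, ∫ x in Ioi (a ((i + 1 : ℕ) : ℝ)), D x ≤
      ∫ x in Ioi (a 1), ⌊invPos a x⌋ * D x := by
  have hle : ∀ i : ℕ, a 1 ≤ a ((i + 1 : ℕ) : ℝ) := fun i =>
    ha_mono.monotoneOn (mem_Ioi.mpr one_pos) (mem_Ioi.mpr (by positivity)) (by simp)
  have e : ∀ i : ℕ, ∫ x in Ioi (a ((i + 1 : ℕ) : ℝ)), D x =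
      ∫ x in Ioi (a 1), (Ioi (a ((i + 1 : ℕ) : ℝ))).indicator D x := fun i => by
    rw [setIntegral_indicator measurableSet_Ioi,
      inter_eq_self_of_subset_right (Ioi_subset_Ioi (hle i))]
  have hint : ∀ i : ℕ, IntegrableOn ((Ioi (a ((i + 1 : ℕ) : ℝ))).indicator D) (Ioi (a 1)) :=
    fun i => hD.indicator measurableSet_Ioi
  simp only [e]
  rw [← integral_finsetSum _ fun i _ => hint i]
  refine setIntegral_mono_on (integrable_finsetSum _ fun i _ => hint i) hN measurableSet_Ioi
    fun x hx => ?_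
  have hx : a 1 < x := hx
  have := mul_le_mul_of_nonneg_right
    (sum_indicator_le_floor_invPos ha_mono ha_surj hx.le N) (hD0 x hx.le)
  refine le_trans (le_of_eq ?_) this
  rw [Finset.sum_mul]
  refine Finset.sum_congr rfl fun i _ => ?_
  by_cases h : x ∈ Ioi (a ((i + 1 : ℕ) : ℝ))
  · rw [indicator_of_mem h, indicator_of_mem h, Pi.one_apply, one_mul]
  · rw [indicator_of_notMem h, indicator_of_notMem h, zero_mul]

/-! ### The bounds for the Mathieu-type series -/

theorem theorem2 (lam eta b c p q r : ℝ) (a : ℝ → ℝ)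
    (hlam0 : 0 < lam) (hlam1 : lam ≤ 1) (heta : 0 < eta)
    (ha_pos : ∀ x : ℝ, 0 < x → 0 < a x)
    (ha_mono : StrictMonoOn a (Set.Ioi 0))
    (ha_surj : Set.SurjOn a (Set.Ioi 0) (Set.Ici (a 1)))
    (ha_lim : Tendsto (fun n : ℕ => a n) atTop atTop)
    (hr0 : 0 < r) (hr1 : r < √(a 1))
    (hp : 0 ≤ p) (hq : 0 ≤ q) (hb : 0 < b) (hbc : b < c) :
    (UConverges a r lam eta →
      (UConverges a r (lam + 1) eta ∧ UConverges a r lam (eta + 1) ∧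
        UConverges a r (lam - 1) (eta + 1)) ∧
      Summable (fun n : ℕ => mathieuTerm lam eta p q b c a r (n + 1)) ∧
      mathieuSeries lam eta p q b c a r ≤
        lam * frakE p q *
          ((1 - 2 * (lam + 1) * b * (c + 1) / (c * (lam + 2) * (b + 1))) * uInt a r (lam + 1) eta
            + 4 * (lam + 1) * b * (c + 1) ^ 2 * uInt a r lam eta
              / (c * (lam + 2) * (b + 1)
                  * ((lam + 2) * (b + 1) * r ^ 2 + 2 * (c + 1) * a 1)))
        + eta * frakE p q *
          ((1 - 2 * lam * b * (c + 1) / (c * (lam + 1) * (b + 1))) * uInt a r lam (eta + 1)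
            + 4 * lam * b * (c + 1) ^ 2 * uInt a r (lam - 1) (eta + 1)
              / (c * (lam + 1) * (b + 1)
                  * ((lam + 1) * (b + 1) * r ^ 2 + 2 * (c + 1) * a 1)))) ∧
    (1 < lam + eta →
      ∃ S : ℝ, Tendsto (altMathieuPartialSum lam eta p q b c a r) atTop (𝓝 S) ∧
        S ≤
          lam * frakE p q *
            ((1 - 2 * (lam + 1) * b * (c + 1) / (c * (lam + 2) * (b + 1)))
                * (ordinaryHypergeometric eta (lam + eta) (lam + eta + 1) (-r ^ 2 / a 1)
                    / ((lam + eta) * a 1 ^ (lam + eta)))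
              + 4 * (lam + 1) * b * (c + 1) ^ 2 / (c * (lam + 2) * (b + 1))
                * (a 1 ^ (1 - lam - eta)
                    * ordinaryHypergeometric eta (lam + eta - 1) (lam + eta) (-r ^ 2 / a 1)
                    / ((lam + eta - 1)
                        * ((lam + 2) * (b + 1) * r ^ 2 + 2 * (c + 1) * a 1))))
          + eta * frakE p q *
            ((1 - 2 * lam * b * (c + 1) / (c * (lam + 1) * (b + 1)))
                * (ordinaryHypergeometric (eta + 1) (lam + eta) (lam + eta + 1) (-r ^ 2 / a 1)
                    / ((lam + eta) * a 1 ^ (lam + eta)))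
              + 4 * lam * b * (c + 1) ^ 2 / (c * (lam + 1) * (b + 1))
                * (a 1 ^ (1 - lam - eta)
                    * ordinaryHypergeometric (eta + 1) (lam + eta - 1) (lam + eta) (-r ^ 2 / a 1)
                    / ((lam + eta - 1)
                        * ((lam + 1) * (b + 1) * r ^ 2 + 2 * (c + 1) * a 1))))) := by
  have ha1 : 0 < a 1 := ha_pos 1 one_pos
  have hr : r ^ 2 < a 1 := (Real.lt_sqrt hr0.le).mp hr1
  have hE : 0 ≤ frakE p q := (Real.exp_pos _).le
  have hle : ∀ i : ℕ, a 1 ≤ a ((i + 1 : ℕ) : ℝ) := fun i =>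
    ha_mono.monotoneOn (mem_Ioi.mpr one_pos) (mem_Ioi.mpr (by positivity)) (by simp)
  have hterm0 : ∀ i : ℕ, 0 ≤ mathieuTerm lam eta p q b c a r (i + 1) := fun i =>
    extGauss_div_nonneg hp hq hlam0 hb hbc (hr.trans_le (hle i))
  have hterm : 1 < lam + eta → ∀ i : ℕ, mathieuTerm lam eta p q b c a r (i + 1) ≤
      frakE p q * ∫ x in Ioi (a ((i + 1 : ℕ) : ℝ)), mathieuMajorant lam eta b c r (a 1) x :=
    fun h i => extGauss_div_le_integral hp hq hlam0 hlam1 heta h hb hbc hr (hle i)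
  refine ⟨fun hU => ?_, fun h => ?_⟩
  · have hU1 := hU.add_one_left ha1
    have hU2 := hU.add_one_right ha1
    have hU3 := hU.sub_one_add_one ha1
    have h := hU.one_lt_add ha_mono ha_surj ha1 heta.le hr.le
    obtain ⟨hI, hval⟩ := integral_floor_mul_mathieuMajorant (b := b) (c := c) (y := a 1)
      hU1 hU hU2 hU3
    -- The terms are nonnegative, so bounded partial sums give summability as well as the estimate.
    have hsum : ∀ N : ℕ, ∑ i ∈ Finset.range N, mathieuTerm lam eta p q b c a r (i + 1) ≤
        frakE p q * ∫ x in Ioi (a 1), ⌊invPos a x⌋ * mathieuMajorant lam eta b c r (a 1) x := by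
      intro N
      refine (Finset.sum_le_sum fun i _ => hterm h i).trans ?_
      rw [← Finset.mul_sum]
      exact mul_le_mul_of_nonneg_left (sum_integral_Ioi_le ha_mono ha_surj
        (fun x hx => mathieuMajorant_nonneg hlam0 hlam1 heta hb hbc ha1 hr.le hx)
        (integrableOn_mathieuMajorant heta h ha1) hI N) hE
    refine ⟨⟨hU1, hU2, hU3⟩, summable_of_sum_range_le hterm0 hsum, ?_⟩
    refine (Real.tsum_le_of_sum_range_le hterm0 hsum).trans (le_of_eq ?_)
    rw [hval]
    simp only [lukeConst, lukeSlope, show lam + 1 + 1 = lam + 2 by ring]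
    ring
  · have hanti : Antitone fun i : ℕ => mathieuTerm lam eta p q b c a r (i + 1) := by
      intro i j hij
      refine extGauss_div_antitoneOn (eta := eta) hp hq hlam0 heta hb hbc
        (mem_Ioi.mpr (hr.trans_le (hle i))) (mem_Ioi.mpr (hr.trans_le (hle j))) ?_
      refine ha_mono.monotoneOn (mem_Ioi.mpr (by positivity)) (mem_Ioi.mpr (by positivity)) ?_
      exact_mod_cast Nat.succ_le_succ hij
    have hlim : Tendsto (fun i : ℕ => mathieuTerm lam eta p q b c a r (i + 1)) atTop (𝓝 0) :=
      ((tendsto_extGauss_div hp hq hlam0 hlam1 heta h hb hbc).comp ha_lim).comp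
        (tendsto_add_atTop_nat 1)
    have heq : altMathieuPartialSum lam eta p q b c a r = fun N =>
        ∑ i ∈ Finset.range N, (-1 : ℝ) ^ i * mathieuTerm lam eta p q b c a r (i + 1) := by
      funext N
      rw [altMathieuPartialSum, ← Finset.Ico_add_one_right_eq_Icc, Finset.sum_Ico_eq_sum_range]
      simp [add_comm]
    obtain ⟨S, hS⟩ := hanti.tendsto_alternating_series_of_tendsto_zero hlim
    refine ⟨S, heq ▸ hS, ?_⟩
    -- An alternating sum with decreasing terms is at most its first term, which the case `z = a 1`
    -- of the integral estimate bounds.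
    have hS1 := hanti.tendsto_le_alternating_series hS 0
    have hS2 := hterm h 0
    simp only [mul_zero, zero_add, Finset.range_one, Finset.sum_singleton, pow_zero, one_mul,
      Nat.cast_one] at hS1 hS2
    refine (hS1.trans hS2).trans (le_of_eq ?_)
    rw [integral_mathieuMajorant heta h hr]
    simp only [lukeConst, lukeSlope, show lam + 1 + 1 = lam + 2 by ring,
      show -(lam + eta - 1) = 1 - lam - eta by ring, Real.rpow_neg ha1.le]
    -- The denominators are kept as atoms, since `ring` would expand them and then fail to match
    -- their inverses.
    generalize (lam + 2) * (b + 1) * r ^ 2 + 2 * (c + 1) * a 1 = D₁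
    generalize (lam + 1) * (b + 1) * r ^ 2 + 2 * (c + 1) * a 1 = D₂
    generalize c * (lam + 2) * (b + 1) = C₁
    generalize c * (lam + 1) * (b + 1) = C₂
    generalize a 1 ^ (1 - lam - eta) = P
    generalize lam + eta - 1 = A
    generalize lam + eta = B
    ring
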